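/- **Refined LaSalle Invariance Principle for differential inclusions.** Let $F:\mathbb{R}^n\rightrightarrows\mathbb{R}^n$ be a set-valued map with nonempty, convex, compact values that is upper semicontinuous, i.e. for all $x\in\mathbb{R}^n$ and $\epsilon>0$ there is $\delta>0$ with $F(y)\subset F(x)+B(0,\epsilon)$ for all $y\in B(x,\delta)$. Let $\varphi:[0,\infty)\to\mathbb{R}^n$ be a bounded solution of $\dot x\in F(x)$, i.e. $\varphi$ is absolutely continuous on every $[0,T]$ and $\dot\varphi(t)\in F(\varphi(t))$ for almost every $t\ge 0$. Let $\Omega(\varphi)$ be its omega-limit set, the set of all limits $\lim_k\varphi(t_k)$ along sequences $t_k\to\infty$, and suppose that $\Omega(\varphi)\subset\mathcal{S}$, where $\mathcal{S}\subset\mathbb{R}^n$ is a closed subset that is an embedded submanifold of $\mathbb{R}^n$ (of class $C^r$ for some $r\ge 1$). Let $\mathcal{O}$ be an open neighborhood of $\mathcal{S}$ and let $W:\mathcal{O}\to\mathbb{R}$ be locally Lipschitz and regular, i.e. for every $x\in\mathcal{O}$ and $v\in\mathbb{R}^n$ the right directional derivative $\lim_{h\downarrow 0}\frac{W(x+hv)-W(x)}{h}$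 exists and equals the generalized directional derivative $\limsup_{y\to x,\,h\downarrow 0}\frac{W(y+hv)-W(y)}{h}$. For $x\in\mathcal{O}$ let $$\partial W(x)=\mathrm{co}\Big\{\lim_{i\to\infty}\nabla W(x_i)\;:\;x_i\to x,\ x_i\notin N\cup\Omega_W\Big\}$$ be the generalized gradient, where $\Omega_W$ is the set of points at which $W$ is not differentiable and $N\subset\mathbb{R}^n$ is any fixed set of measure zero, and let $$\mathcal{L}_FW(x)=\{a\in\mathbb{R}\;:\;\exists v\in F(x)\text{ such that }\zeta^\top v=a\text{ for all }\zeta\in\partial W(x)\}$$ be the set-valued Lie derivative, with the convention $\max\emptyset=-\infty$. Assume that 1. the set $\mathcal{E}=\{x\in\mathcal{S}: 0\in\mathcal{L}_FW(x)\}$ is contained in a level set of $W$, i.e. $W$ is constant on $\mathcal{E}$; 2. for every compact set $\mathcal{M}\subset\mathcal{S}$ with $\mathcal{M}\cap\mathcal{E}=\emptyset$ there exist a compact neighborhood $\mathcal{M}_c\subset\mathcal{O}$ of $\mathcal{M}$ in $\mathbb{R}^n$ and $\delta<0$ such that $\sup_{x\in\mathcal{M}_c}\max\mathcal{L}_FW(x)\le\delta$.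 Then $\Omega(\varphi)\subset\mathcal{E}$. -/

import Mathlib

open Filter Topology Set MeasureTheory
open scoped Pointwise

namespace NonsmoothLaSalle

/-- Upper semicontinuity of a set-valued map `F : ℝⁿ ⇉ ℝⁿ`: for every `x` and every `ε > 0` there
is `δ > 0` with `F y ⊆ F x + B(0, ε)` for all `y ∈ B(x, δ)`. -/
def IsUpperSemicontinuous {n : ℕ}
    (F : EuclideanSpace ℝ (Fin n) → Set (EuclideanSpace ℝ (Fin n))) : Prop :=
  ∀ x, ∀ ε > 0, ∃ δ > 0, ∀ y ∈ Metric.ball x δ, F y ⊆ F x + Metric.ball 0 ε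

/-- `φ`, regarded as a map on `[0, ∞)`, is a solution of the differential inclusion `ẋ ∈ F(x)`:
it is absolutely continuous on every interval `[0, T]`, and for almost every `t ≥ 0` its derivative
exists and lies in `F (φ t)`. -/
def IsSolution {n : ℕ} (F : EuclideanSpace ℝ (Fin n) → Set (EuclideanSpace ℝ (Fin n)))
    (φ : ℝ → EuclideanSpace ℝ (Fin n)) : Prop :=
  (∀ T > 0, AbsolutelyContinuousOnInterval φ 0 T) ∧
    ∀ᵐ t ∂(volume.restrict (Ici (0 : ℝ))), ∃ v ∈ F (φ t), HasDerivAt φ v t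

/-- The omega-limit set of a trajectory: all limits of `φ (t_k)` along sequences `t_k → ∞`. -/
def omegaLimitSet {n : ℕ} (φ : ℝ → EuclideanSpace ℝ (Fin n)) : Set (EuclideanSpace ℝ (Fin n)) :=
  {y | ∃ t : ℕ → ℝ, Tendsto t atTop atTop ∧ Tendsto (fun k => φ (t k)) atTop (𝓝 y)}

/-- `S` is an embedded submanifold of `ℝⁿ` of class `C^r`: for some dimension `k ≤ n`, every point
of `S` lies in the domain of a `C^r` diffeomorphism `Φ` between open subsets of `ℝⁿ` which carries
`S` onto the slice where the coordinates with (zero-based) index at least `k` vanish. -/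
def IsEmbeddedSubmanifold {n : ℕ} (r : WithTop ℕ∞) (S : Set (EuclideanSpace ℝ (Fin n))) : Prop :=
  ∃ k ≤ n, ∀ p ∈ S,
    ∃ Φ : OpenPartialHomeomorph (EuclideanSpace ℝ (Fin n)) (EuclideanSpace ℝ (Fin n)),
      p ∈ Φ.source ∧ ContDiffOn ℝ r Φ Φ.source ∧ ContDiffOn ℝ r Φ.symm Φ.target ∧
        ∀ x ∈ Φ.source, x ∈ S ↔ ∀ i : Fin n, k ≤ (i : ℕ) → Φ x i = 0

/-- The generalized (Clarke) directional derivative of `f` at `x` in the direction `v`: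
the limsup of `(f (y + h v) - f y) / h` as `y → x` and `h ↓ 0`. For a function that is Lipschitz
near `x` the quotients are bounded, so that this is a genuine real limsup. -/
noncomputable def generalizedDirDeriv {n : ℕ} (f : EuclideanSpace ℝ (Fin n) → ℝ)
    (x v : EuclideanSpace ℝ (Fin n)) : ℝ :=
  limsup (fun p : EuclideanSpace ℝ (Fin n) × ℝ => (f (p.1 + p.2 • v) - f p.1) / p.2)
    (𝓝 x ×ˢ 𝓝[>] (0 : ℝ))

/-- `f` is regular at `x`: for every direction `v` the right directional derivative of `f` at `x`
exists and coincides with the generalized directional derivative. -/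
def IsRegularAt {n : ℕ} (f : EuclideanSpace ℝ (Fin n) → ℝ)
    (x : EuclideanSpace ℝ (Fin n)) : Prop :=
  ∀ v, Tendsto (fun h : ℝ => (f (x + h • v) - f x) / h) (𝓝[>] (0 : ℝ))
    (𝓝 (generalizedDirDeriv f x v))

/-- The generalized gradient `∂f(x)`: the convex hull of all limits of gradients `∇f(x_i)` along
sequences `x_i → x` that avoid the set `N` and the points where `f` is not differentiable. Here `N`
stands for an arbitrary set of measure zero. -/
noncomputable def generalizedGradient {n : ℕ} (N : Set (EuclideanSpace ℝ (Fin n)))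
    (f : EuclideanSpace ℝ (Fin n) → ℝ) (x : EuclideanSpace ℝ (Fin n)) :
    Set (EuclideanSpace ℝ (Fin n)) :=
  convexHull ℝ {ζ | ∃ u : ℕ → EuclideanSpace ℝ (Fin n), Tendsto u atTop (𝓝 x) ∧
    (∀ i, u i ∉ N ∧ DifferentiableAt ℝ f (u i)) ∧
    Tendsto (fun i => gradient f (u i)) atTop (𝓝 ζ)}

/-- The set-valued Lie derivative `𝓛_F f(x)`: all reals `a` for which some `v ∈ F x` satisfies
`⟨ζ, v⟩ = a` for every `ζ ∈ ∂f(x)`. -/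
def setValuedLieDeriv {n : ℕ} (N : Set (EuclideanSpace ℝ (Fin n)))
    (F : EuclideanSpace ℝ (Fin n) → Set (EuclideanSpace ℝ (Fin n)))
    (f : EuclideanSpace ℝ (Fin n) → ℝ) (x : EuclideanSpace ℝ (Fin n)) : Set ℝ :=
  {a | ∃ v ∈ F x, ∀ ζ ∈ generalizedGradient N f x, inner ℝ ζ v = a}

/-- `max 𝓛_F f(x)` as an extended real number, with the usual convention `max ∅ = -∞`. -/
noncomputable def maxLieDeriv {n : ℕ} (N : Set (EuclideanSpace ℝ (Fin n)))
    (F : EuclideanSpace ℝ (Fin n) → Set (EuclideanSpace ℝ (Fin n)))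
    (f : EuclideanSpace ℝ (Fin n) → ℝ) (x : EuclideanSpace ℝ (Fin n)) : EReal :=
  sSup ((fun a : ℝ => (a : EReal)) '' setValuedLieDeriv N F f x)

end NonsmoothLaSalle

/-! At a time where both `φ` and `W ∘ φ` are differentiable, regularity of `W` forces every
generalized gradient to have the same pairing with the velocity, so the derivative of `W ∘ φ` lies
in the set-valued Lie derivative (`inner_eq_of_hasDerivAt_comp`). Hence `W` decays at a uniform rate
wherever condition 2 applies. Condition 2 covers the limit points with `|W - c| ≥ η`, where `c` is
the value of `W` on `E`. The trajectory cannot stay in that region, nor come back above `c + η`, nor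
sink to `c - η`; so `W ∘ φ` tends to `c` (`tendsto_comp`). Near a limit point outside `E`, bounded
speed makes every visit last a fixed time and cost a fixed drop of `W`, contradicting convergence
(`notMem_interior_of_tendsto`). Invariance of the limit set is never needed. -/

namespace NonsmoothLaSalle

/-! ### Calculus along absolutely continuous curves -/

/-- Postcomposition with a Lipschitz map preserves absolute continuity. -/
theorem absolutelyContinuousOnInterval_comp {X Y : Type*} [PseudoMetricSpace X]
    [PseudoMetricSpace Y] {g : X → Y} {f : ℝ → X} {a b : ℝ} {K : NNReal}
    (hg : LipschitzOnWith K g (f '' uIcc a b)) (hf : AbsolutelyContinuousOnInterval f a b) :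
    AbsolutelyContinuousOnInterval (fun t => g (f t)) a b := by
  rw [absolutelyContinuousOnInterval_iff] at hf ⊢
  intro ε hε
  -- `K` may be zero, hence the division by `K + 1`.
  obtain ⟨δ, hδ, h⟩ := hf (ε / (K + 1)) (by positivity)
  refine ⟨δ, hδ, fun P hP hlen => ?_⟩
  have hsum := h P hP hlen
  calc ∑ i ∈ Finset.range P.1, dist (g (f (P.2 i).1)) (g (f (P.2 i).2))
      ≤ ∑ i ∈ Finset.range P.1, (K + 1 : ℝ) * dist (f (P.2 i).1) (f (P.2 i).2) := by
        refine Finset.sum_le_sum fun i hi => ?_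
        have hmem := hP.1 i hi
        refine (hg.dist_le_mul _ (mem_image_of_mem f hmem.1) _
          (mem_image_of_mem f hmem.2)).trans ?_
        gcongr
        linarith
    _ = (K + 1 : ℝ) * ∑ i ∈ Finset.range P.1, dist (f (P.2 i).1) (f (P.2 i).2) := by
        rw [Finset.mul_sum]
    _ < (K + 1 : ℝ) * (ε / (K + 1)) := by gcongr
    _ = ε := by field_simp

/-- An absolutely continuous function whose derivative is a.e. bounded above by `δ` grows at most
at rate `δ`. -/
theorem sub_le_mul_of_ae_deriv_le {f : ℝ → ℝ} {a b δ : ℝ} (hab : a ≤ b)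
    (hf : AbsolutelyContinuousOnInterval f a b)
    (h : ∀ᵐ t, t ∈ Icc a b → ∀ d, HasDerivAt f d t → d ≤ δ) :
    f b - f a ≤ δ * (b - a) := by
  rw [← hf.integral_deriv_eq_sub]
  have hconst : ∫ _ in a..b, δ = δ * (b - a) := by
    simp [mul_comm]
  rw [← hconst]
  refine intervalIntegral.integral_mono_ae_restrict hab hf.intervalIntegrable_deriv
    intervalIntegrable_const ?_
  rw [EventuallyLE, ae_restrict_iff' measurableSet_Icc]
  -- Absolute continuity supplies differentiability a.e., so `h` need only bound derivatives that
  -- exist.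
  filter_upwards [h, hf.ae_differentiableAt] with t ht hdiff htI
  exact ht htI _ (hdiff (by rwa [uIcc_of_le hab])).hasDerivAt

/-- A locally Lipschitz function has the same derivative along tangent curves. -/
theorem hasDerivAt_comp_of_tangent {V : Type*} [NormedAddCommGroup V] [NormedSpace ℝ V]
    {f : V → ℝ} {γ₁ γ₂ : ℝ → V} {t : ℝ} {v : V} {a : ℝ} {K : NNReal} {U : Set V}
    (hU : U ∈ 𝓝 (γ₁ t)) (hf : LipschitzOnWith K f U) (heq : γ₂ t = γ₁ t)
    (h₁ : HasDerivAt γ₁ v t) (h₂ : HasDerivAt γ₂ v t)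
    (ha : HasDerivAt (fun s => f (γ₁ s)) a t) : HasDerivAt (fun s => f (γ₂ s)) a t := by
  have hd : HasDerivAt (fun s => γ₂ s - γ₁ s) 0 t := by simpa using h₂.fun_sub h₁
  have hsmall : HasDerivAt (fun s => f (γ₂ s) - f (γ₁ s)) 0 t := by
    rw [hasDerivAt_iff_isLittleO] at hd ⊢
    refine Asymptotics.IsBigO.trans_isLittleO ?_ hd
    refine Asymptotics.IsBigO.of_bound K ?_
    filter_upwards [h₁.continuousAt.preimage_mem_nhds hU,
      h₂.continuousAt.preimage_mem_nhds (by rwa [heq])] with s hs₁ hs₂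
    have := hf.dist_le_mul _ hs₂ _ hs₁
    simpa [heq, dist_eq_norm] using this
  simpa using hsmall.fun_add ha

/-! ### Clarke derivatives and regularity -/

variable {n : ℕ}

/-- The difference quotients defining the generalized directional derivative of a function that is
Lipschitz near `x` are bounded above. -/
theorem isBoundedUnder_quotient {f : EuclideanSpace ℝ (Fin n) → ℝ}
    {x : EuclideanSpace ℝ (Fin n)} {K : NNReal} {U : Set (EuclideanSpace ℝ (Fin n))}
    (hU : U ∈ 𝓝 x) (hf : LipschitzOnWith K f U) (v : EuclideanSpace ℝ (Fin n)) :
    (𝓝 x ×ˢ 𝓝[>] (0 : ℝ)).IsBoundedUnder (· ≤ ·)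
      (fun p : EuclideanSpace ℝ (Fin n) × ℝ => (f (p.1 + p.2 • v) - f p.1) / p.2) := by
  refine ⟨K * ‖v‖, ?_⟩
  rw [eventually_map]
  have hfst : Tendsto (fun p : EuclideanSpace ℝ (Fin n) × ℝ => p.1)
      (𝓝 x ×ˢ 𝓝[>] (0 : ℝ)) (𝓝 x) := tendsto_fst
  have hsnd : Tendsto (fun p : EuclideanSpace ℝ (Fin n) × ℝ => p.2)
      (𝓝 x ×ˢ 𝓝[>] (0 : ℝ)) (𝓝 0) := tendsto_snd.mono_right nhdsWithin_le_nhds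
  have hadd : Tendsto (fun p : EuclideanSpace ℝ (Fin n) × ℝ => p.1 + p.2 • v)
      (𝓝 x ×ˢ 𝓝[>] (0 : ℝ)) (𝓝 x) := by
    simpa using hfst.add (hsnd.smul_const v)
  have hpos : ∀ᶠ p : EuclideanSpace ℝ (Fin n) × ℝ in 𝓝 x ×ˢ 𝓝[>] (0 : ℝ), 0 < p.2 :=
    tendsto_snd.eventually self_mem_nhdsWithin
  filter_upwards [hfst hU, hadd hU, hpos] with p h₁ h₂ h₃
  rw [div_le_iff₀ h₃]
  have := (le_abs_self _).trans (hf.dist_le_mul _ h₂ _ h₁)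
  rw [dist_eq_norm, add_sub_cancel_left, norm_smul, Real.norm_of_nonneg h₃.le] at this
  linarith

/-- The generalized directional derivative dominates the pairing with generalized gradients. -/
theorem inner_le_generalizedDirDeriv {f : EuclideanSpace ℝ (Fin n) → ℝ}
    {x : EuclideanSpace ℝ (Fin n)} {K : NNReal} {U : Set (EuclideanSpace ℝ (Fin n))}
    (hU : U ∈ 𝓝 x) (hf : LipschitzOnWith K f U) (N : Set (EuclideanSpace ℝ (Fin n)))
    {ζ : EuclideanSpace ℝ (Fin n)} (hζ : ζ ∈ generalizedGradient N f x)
    (v : EuclideanSpace ℝ (Fin n)) : inner ℝ ζ v ≤ generalizedDirDeriv f x v := by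
  suffices hsub : generalizedGradient N f x ⊆
      {ζ | inner ℝ ζ v ≤ generalizedDirDeriv f x v} from hsub hζ
  refine convexHull_min ?_ ?_
  · rintro ξ ⟨u, hu, hud, hg⟩
    refine le_of_forall_lt (α := ℝ) fun c hc => ?_
    obtain ⟨c', hcc', hc'⟩ := exists_between hc
    refine hcc'.trans_le (le_limsup_of_frequently_le ?_ (isBoundedUnder_quotient hU hf v))
    intro hnot
    have hinner : Tendsto (fun i => inner ℝ (gradient f (u i)) v) atTop (𝓝 (inner ℝ ξ v)) :=
      hg.inner tendsto_const_nhds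
    -- Currying the joint filter fixes the base point `u i` first, leaving `h ↓ 0` free to recover
    -- the gradient there.
    obtain ⟨i, hi₁, hi₂⟩ :=
      ((hu.eventually hnot.curry).and (hinner.eventually (lt_mem_nhds hc'))).exists
    have hline : HasDerivAt (fun h : ℝ => f (u i + h • v)) (inner ℝ (gradient f (u i)) v) 0 := by
      have h₁ := (hud i).2.hasGradientAt.hasFDerivAt
      have h₂ : HasDerivAt (fun h : ℝ => u i + h • v) v 0 := by
        simpa using ((hasDerivAt_id (0 : ℝ)).smul_const v).const_add (u i)
      have h₃ := HasFDerivAt.comp_hasDerivAt_of_eq (0 : ℝ) h₁ h₂ (by simp)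
      simpa using! h₃
    have hslope : Tendsto (fun h : ℝ => (f (u i + h • v) - f (u i)) / h) (𝓝[>] (0 : ℝ))
        (𝓝 (inner ℝ (gradient f (u i)) v)) := by
      have := hline.tendsto_slope_zero_right
      simpa [div_eq_inv_mul] using this
    obtain ⟨h, hh₁, hh₂⟩ := (hi₁.and (hslope.eventually (lt_mem_nhds hi₂))).exists
    exact hh₁ hh₂.le
  · intro ξ hξ ξ' hξ' s t hs ht hst
    simp only [mem_ofPred_eq] at hξ hξ' ⊢
    rw [inner_add_left, real_inner_smul_left, real_inner_smul_left]
    calc s * inner ℝ ξ v + t * inner ℝ ξ' v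
        ≤ s * generalizedDirDeriv f x v + t * generalizedDirDeriv f x v := by gcongr
      _ = generalizedDirDeriv f x v := by rw [← add_mul, hst, one_mul]

/-- The derivative of a regular function along a curve pairs constantly with the generalized
gradient. -/
theorem inner_eq_of_hasDerivAt_comp {f : EuclideanSpace ℝ (Fin n) → ℝ}
    {γ : ℝ → EuclideanSpace ℝ (Fin n)} {t a : ℝ} {v : EuclideanSpace ℝ (Fin n)}
    {K : NNReal} {U : Set (EuclideanSpace ℝ (Fin n))} (hU : U ∈ 𝓝 (γ t))
    (hf : LipschitzOnWith K f U) (hreg : IsRegularAt f (γ t)) (hγ : HasDerivAt γ v t)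
    (ha : HasDerivAt (fun s => f (γ s)) a t) (N : Set (EuclideanSpace ℝ (Fin n)))
    {ζ : EuclideanSpace ℝ (Fin n)} (hζ : ζ ∈ generalizedGradient N f (γ t)) :
    inner ℝ ζ v = a := by
  -- Regularity only sees straight lines, so the curve is replaced by its tangent line.
  have hline : HasDerivAt (fun s : ℝ => f (γ t + (s - t) • v)) a t := by
    refine hasDerivAt_comp_of_tangent hU hf (by simp) hγ ?_ ha
    simpa using (((hasDerivAt_id t).sub_const t).smul_const v).const_add (γ t)
  have hright : generalizedDirDeriv f (γ t) v = a := by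
    refine tendsto_nhds_unique (hreg v) ?_
    simpa [div_eq_inv_mul] using hline.tendsto_slope_zero_right
  -- Running the line backwards gives the bound for `-v`; the two bounds squeeze `inner ℝ ζ v` to
  -- `a`.
  have hneg : HasDerivAt (fun s : ℝ => f (γ t + s • (-v))) (-a) 0 := by
    have h₁ : HasDerivAt (fun s : ℝ => t - s) (-1) 0 := by
      simpa using (hasDerivAt_id (0 : ℝ)).const_sub t
    have h₂ := HasDerivAt.comp_of_eq (0 : ℝ) hline h₁ (by simp)
    simpa [Function.comp_def] using! h₂
  have hleft : generalizedDirDeriv f (γ t) (-v) = -a := by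
    refine tendsto_nhds_unique (hreg (-v)) ?_
    simpa [div_eq_inv_mul] using hneg.tendsto_slope_zero_right
  have h₁ := inner_le_generalizedDirDeriv hU hf N hζ v
  have h₂ := inner_le_generalizedDirDeriv hU hf N hζ (-v)
  rw [hleft, inner_neg_right] at h₂
  linarith

/-! ### Decay and speed bounds along solutions -/

variable {F : EuclideanSpace ℝ (Fin n) → Set (EuclideanSpace ℝ (Fin n))}
  {φ : ℝ → EuclideanSpace ℝ (Fin n)}

theorem IsSolution.absolutelyContinuousOnInterval (hφ : IsSolution F φ) {a b : ℝ} (ha : 0 ≤ a)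
    (hab : a ≤ b) : AbsolutelyContinuousOnInterval φ a b := by
  -- `IsSolution` asks for `T > 0`, while `b` may be `0`.
  refine (hφ.1 (b + 1) (by linarith)).mono ?_
  rw [uIcc_of_le hab, uIcc_of_le (by linarith)]
  exact Icc_subset_Icc ha (by linarith)

theorem IsSolution.continuousOn (hφ : IsSolution F φ) {a b : ℝ} (ha : 0 ≤ a)
    (hab : a ≤ b) : ContinuousOn φ (Icc a b) := by
  simpa [uIcc_of_le hab] using (hφ.absolutelyContinuousOnInterval ha hab).continuousOn

/-- A solution changes `W` at rate at most `δ` as long as it stays in a set where the set-valued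
Lie derivative is at most `δ`. -/
theorem IsSolution.sub_le_mul_of_forall_mem (hφ : IsSolution F φ)
    {O : Set (EuclideanSpace ℝ (Fin n))} (hO : IsOpen O) {W : EuclideanSpace ℝ (Fin n) → ℝ}
    (hW : LocallyLipschitzOn O W) (hreg : ∀ x ∈ O, IsRegularAt W x)
    {N Q : Set (EuclideanSpace ℝ (Fin n))} (hQO : Q ⊆ O) {δ : ℝ}
    (hQ : ∀ x ∈ Q, ∀ a ∈ setValuedLieDeriv N F W x, a ≤ δ) {a b : ℝ} (ha : 0 ≤ a) (hab : a ≤ b)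
    (hmem : ∀ t ∈ Icc a b, φ t ∈ Q) : W (φ b) - W (φ a) ≤ δ * (b - a) := by
  have hac := hφ.absolutelyContinuousOnInterval ha hab
  have himage : φ '' uIcc a b ⊆ O := by
    rw [uIcc_of_le hab]
    rintro _ ⟨t, ht, rfl⟩
    exact hQO (hmem t ht)
  obtain ⟨K, hK⟩ := LocallyLipschitzOn.exists_lipschitzOnWith_of_compact
    (isCompact_uIcc.image_of_continuousOn hac.continuousOn) (hW.mono himage)
  refine sub_le_mul_of_ae_deriv_le hab (absolutelyContinuousOnInterval_comp hK hac) ?_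
  have hae := hφ.2
  rw [ae_restrict_iff' measurableSet_Ici] at hae
  filter_upwards [hae] with t ht htI d hd
  obtain ⟨v, hv, hder⟩ := ht (ha.trans htI.1)
  have hQt := hmem t htI
  obtain ⟨K', U, hU, hKU⟩ := hW (hQO hQt)
  rw [hO.nhdsWithin_eq (hQO hQt)] at hU
  exact hQ _ hQt d ⟨v, hv, fun ζ hζ =>
    inner_eq_of_hasDerivAt_comp hU hKU (hreg _ (hQO hQt)) hder hd N hζ⟩

/-- An upper semicontinuous map with compact values is bounded on compact sets. -/
theorem IsUpperSemicontinuous.exists_norm_le (hF : IsUpperSemicontinuous F)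
    (hF_compact : ∀ x, IsCompact (F x)) {Q : Set (EuclideanSpace ℝ (Fin n))} (hQ : IsCompact Q) :
    ∃ R : ℝ, ∀ x ∈ Q, ∀ v ∈ F x, ‖v‖ ≤ R := by
  refine hQ.induction_on (p := fun s => ∃ R : ℝ, ∀ x ∈ s, ∀ v ∈ F x, ‖v‖ ≤ R) ⟨0, by simp⟩
    (fun s t hst ⟨R, hR⟩ => ⟨R, fun x hx => hR x (hst hx)⟩)
    (fun s t ⟨R, hR⟩ ⟨R', hR'⟩ => ⟨max R R', ?_⟩) fun x _ => ?_
  · rintro x (hx | hx) v hv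
    · exact (hR x hx v hv).trans (le_max_left _ _)
    · exact (hR' x hx v hv).trans (le_max_right _ _)
  · obtain ⟨R, hR⟩ := (hF_compact x).isBounded.exists_norm_le
    obtain ⟨δ, hδ, hsub⟩ := hF x 1 one_pos
    refine ⟨Metric.ball x δ, mem_nhdsWithin_of_mem_nhds (Metric.ball_mem_nhds x hδ), R + 1,
      fun y hy v hv => ?_⟩
    obtain ⟨w, hw, z, hz, rfl⟩ := hsub y hy hv
    have hz' : ‖z‖ < 1 := by simpa using hz
    exact (norm_add_le _ _).trans (add_le_add (hR w hw) hz'.le)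

/-- A bounded solution is Lipschitz. -/
theorem IsSolution.exists_dist_le (hφ : IsSolution F φ) (hF : IsUpperSemicontinuous F)
    (hF_compact : ∀ x, IsCompact (F x)) (hb : Bornology.IsBounded (φ '' Ici (0 : ℝ))) :
    ∃ R : ℝ, 0 < R ∧ ∀ a b : ℝ, 0 ≤ a → a ≤ b → dist (φ b) (φ a) ≤ R * (b - a) := by
  obtain ⟨R, hR⟩ := hF.exists_norm_le hF_compact hb.isCompact_closure
  refine ⟨max R 1, by positivity, fun a b ha hab => ?_⟩
  rcases eq_or_ne (φ b) (φ a) with heq | hne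
  · rw [heq, dist_self]
    exact mul_nonneg (by positivity) (by linarith)
  -- Pairing the curve with its own displacement reduces the estimate to the scalar case.
  set w := φ b - φ a with hw
  have hwpos : 0 < ‖w‖ := norm_pos_iff.2 (sub_ne_zero.2 hne)
  have hac := hφ.absolutelyContinuousOnInterval ha hab
  have hlip : LipschitzOnWith ‖innerSL ℝ w‖₊ (innerSL ℝ w) (φ '' uIcc a b) :=
    (innerSL ℝ w).lipschitz.lipschitzOnWith
  have hkey := sub_le_mul_of_ae_deriv_le (δ := ‖w‖ * max R 1) hab
    (absolutelyContinuousOnInterval_comp hlip hac) ?_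
  · simp only [innerSL_apply_apply] at hkey
    rw [← inner_sub_right, ← hw, real_inner_self_eq_norm_sq] at hkey
    rw [dist_eq_norm, ← hw]
    refine le_of_mul_le_mul_left ?_ hwpos
    linarith
  · have hae := hφ.2
    rw [ae_restrict_iff' measurableSet_Ici] at hae
    filter_upwards [hae] with t ht htI d hd
    obtain ⟨v, hv, hder⟩ := ht (ha.trans htI.1)
    have hd' : d = inner ℝ w v :=
      hd.unique ((innerSL ℝ w).hasFDerivAt.comp_hasDerivAt t hder)
    have hvR := hR _ (subset_closure (mem_image_of_mem φ (ha.trans htI.1))) v hv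
    rw [hd']
    refine (real_inner_le_norm _ _).trans ?_
    gcongr
    exact hvR.trans (le_max_left _ _)

/-! ### Omega-limit sets -/

/-- A bounded trajectory eventually enters every open set containing its omega-limit set. -/
theorem eventually_mem_of_omegaLimitSet_subset (hb : Bornology.IsBounded (φ '' Ici (0 : ℝ)))
    {U : Set (EuclideanSpace ℝ (Fin n))} (hU : IsOpen U) (hsub : omegaLimitSet φ ⊆ U) :
    ∀ᶠ t in atTop, φ t ∈ U := by
  by_contra hnot
  obtain ⟨s, hs, hsU⟩ := exists_seq_forall_of_frequently
    ((not_eventually.1 hnot).and_eventually (eventually_ge_atTop (0 : ℝ)))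
  obtain ⟨y, -, k, hk, hlim⟩ := hb.isCompact_closure.tendsto_subseq
    (fun i => subset_closure (mem_image_of_mem φ (hsU i).2))
  have hy : y ∈ U := hsub ⟨fun i => s (k i), hs.comp hk.tendsto_atTop, hlim⟩
  obtain ⟨i, hi⟩ := (hlim.eventually (hU.mem_nhds hy)).exists
  exact (hsU (k i)).1 hi

theorem isClosed_omegaLimitSet (φ : ℝ → EuclideanSpace ℝ (Fin n)) :
    IsClosed (omegaLimitSet φ) := by
  have heq : omegaLimitSet φ = {y | MapClusterPt y atTop φ} := by
    ext y
    constructor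
    · rintro ⟨t, ht, hlim⟩
      exact hlim.mapClusterPt.of_comp ht
    · intro hy
      have hne : (atTop ⊓ comap φ (𝓝 y)).NeBot := by
        rw [neBot_inf_comap_iff_map, inf_comm]
        exact hy
      obtain ⟨t, ht⟩ := exists_seq_tendsto (atTop ⊓ comap φ (𝓝 y))
      rw [tendsto_inf, tendsto_comap_iff] at ht
      exact ⟨t, ht.1, ht.2⟩
  rw [heq]
  exact isClosed_setOfPred_clusterPt

theorem isCompact_omegaLimitSet (hb : Bornology.IsBounded (φ '' Ici (0 : ℝ))) :
    IsCompact (omegaLimitSet φ) := by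
  refine hb.isCompact_closure.of_isClosed_subset (isClosed_omegaLimitSet φ) ?_
  rintro y ⟨t, ht, hlim⟩
  exact mem_closure_of_tendsto hlim
    ((ht.eventually_ge_atTop 0).mono fun k hk => mem_image_of_mem φ hk)

/-! ### Convergence of `W` along the solution -/

/-- A solution with an omega-limit point cannot stay forever in a set where `W` decreases at a
uniform rate. -/
theorem IsSolution.not_eventually_mem (hφ : IsSolution F φ)
    {O : Set (EuclideanSpace ℝ (Fin n))} (hO : IsOpen O) {W : EuclideanSpace ℝ (Fin n) → ℝ}
    (hW : LocallyLipschitzOn O W) (hreg : ∀ x ∈ O, IsRegularAt W x)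
    {N Q : Set (EuclideanSpace ℝ (Fin n))} (hQO : Q ⊆ O) {δ : ℝ} (hδ : δ < 0)
    (hQ : ∀ x ∈ Q, ∀ a ∈ setValuedLieDeriv N F W x, a ≤ δ)
    {y : EuclideanSpace ℝ (Fin n)} (hy : y ∈ omegaLimitSet φ) (hyO : y ∈ O) :
    ¬ ∀ᶠ t in atTop, φ t ∈ Q := by
  intro hev
  obtain ⟨T, hT⟩ := eventually_atTop.1 (hev.and (eventually_ge_atTop (0 : ℝ)))
  obtain ⟨s, hs, hlim⟩ := hy
  have hWlim : Tendsto (fun k => W (φ (s k))) atTop (𝓝 (W y)) :=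
    (hW.continuousOn.continuousAt (hO.mem_nhds hyO)).tendsto.comp hlim
  refine not_tendsto_nhds_of_tendsto_atBot ?_ _ hWlim
  have hbot : Tendsto (fun k => W (φ T) + δ * (s k - T)) atTop atBot :=
    tendsto_atBot_add_const_left _ _
      ((tendsto_atTop_add_const_right _ (-T) hs).const_mul_atTop_of_neg hδ)
  refine tendsto_atBot_mono' _ ?_ hbot
  filter_upwards [hs.eventually_ge_atTop T] with k hk
  have := hφ.sub_le_mul_of_forall_mem hO hW hreg hQO hQ (hT T le_rfl).2 hk
    fun t ht => (hT t ht.1).1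
  linarith

/-- If `W` decreases along a solution wherever `|W - c| ≥ η`, then the sublevel sets of `W` at
heights `b` with `|b - c| ≥ η` are forward invariant. -/
theorem IsSolution.le_of_trapped (hφ : IsSolution F φ)
    {O : Set (EuclideanSpace ℝ (Fin n))} (hO : IsOpen O) {W : EuclideanSpace ℝ (Fin n) → ℝ}
    (hW : LocallyLipschitzOn O W) (hreg : ∀ x ∈ O, IsRegularAt W x)
    {N Q : Set (EuclideanSpace ℝ (Fin n))} (hQO : Q ⊆ O) {δ : ℝ} (hδ : δ < 0)
    (hQ : ∀ x ∈ Q, ∀ a ∈ setValuedLieDeriv N F W x, a ≤ δ) {c η T : ℝ} (hT : 0 ≤ T)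
    (htrap : ∀ t ≥ T, φ t ∈ O ∧ (η ≤ |W (φ t) - c| → φ t ∈ interior Q)) {b : ℝ}
    (hb : η ≤ |b - c|) (hTb : W (φ T) ≤ b) : ∀ t ≥ T, W (φ t) ≤ b := by
  intro t ht
  have hcont : ContinuousOn (fun s => W (φ s)) (Icc T t) :=
    hW.continuousOn.comp (hφ.continuousOn hT ht) fun s hs => (htrap s hs.1).1
  have hclosed : IsClosed ({s | W (φ s) ≤ b} ∩ Icc T t) := by
    rw [inter_comm]
    exact hcont.preimage_isClosed_of_isClosed isClosed_Icc isClosed_Iic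
  -- Continuous induction: below height `b` continuity allows a step forward; at height `b` the
  -- point lies in `interior Q`, where `W` decays.
  refine hclosed.Icc_subset_of_forall_exists_gt hTb ?_ (right_mem_Icc.2 ht)
  rintro x ⟨hxb, hx⟩ y hy
  rw [mem_ofPred_eq] at hxb
  have hIoo : Ioo x (min y t) ∈ 𝓝[>] x := Ioo_mem_nhdsGT (lt_min hy hx.2)
  have hxI : x ∈ Icc T t := ⟨hx.1, hx.2.le⟩
  have hle : 𝓝[>] x ≤ 𝓝[Icc T t] x := by
    rw [← nhdsWithin_Ioo_eq_nhdsGT hx.2]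
    exact nhdsWithin_mono _ fun s hs => ⟨hx.1.trans hs.1.le, hs.2.le⟩
  rcases lt_or_eq_of_le hxb with hlt | heq
  · have hev : ∀ᶠ s in 𝓝[>] x, W (φ s) < b :=
      ((hcont x hxI).mono_left hle).eventually (gt_mem_nhds hlt)
    obtain ⟨s, hs, hsI⟩ := (hev.and hIoo).exists
    exact ⟨s, hs.le, hsI.1, (hsI.2.trans_le (min_le_left _ _)).le⟩
  · have hxQ : φ x ∈ interior Q := (htrap x hx.1).2 (by rwa [heq])
    have hev : ∀ᶠ s in 𝓝[>] x, φ s ∈ interior Q :=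
      ((hφ.continuousOn hT ht x hxI).mono_left hle).eventually (isOpen_interior.mem_nhds hxQ)
    obtain ⟨u, hu, hsub⟩ := mem_nhdsGT_iff_exists_Ioo_subset.1 hev
    obtain ⟨s, hs₁, hs₂⟩ := exists_between (lt_min hu (lt_min hy hx.2))
    have hdec := hφ.sub_le_mul_of_forall_mem hO hW hreg hQO hQ (hT.trans hx.1) hs₁.le
      fun r hr => by
        rcases eq_or_lt_of_le hr.1 with rfl | hlt
        · exact interior_subset hxQ
        · exact interior_subset (hsub ⟨hlt, hr.2.trans_lt (hs₂.trans_le (min_le_left _ _))⟩)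
    have hsy : s < y := hs₂.trans_le ((min_le_right _ _).trans (min_le_left _ _))
    refine ⟨s, ?_, hs₁, hsy.le⟩
    have : δ * (s - x) ≤ 0 := mul_nonpos_of_nonpos_of_nonneg hδ.le (by linarith)
    rw [mem_ofPred_eq]
    linarith

/-- If outside every neighbourhood of the level `c` the function `W` decreases at a uniform rate
near the omega-limit set, then `W` tends to `c` along the solution. -/
theorem IsSolution.tendsto_comp (hφ : IsSolution F φ)
    (hb : Bornology.IsBounded (φ '' Ici (0 : ℝ)))
    {O : Set (EuclideanSpace ℝ (Fin n))} (hO : IsOpen O) {W : EuclideanSpace ℝ (Fin n) → ℝ}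
    (hW : LocallyLipschitzOn O W) (hreg : ∀ x ∈ O, IsRegularAt W x)
    {N : Set (EuclideanSpace ℝ (Fin n))} (hΩO : omegaLimitSet φ ⊆ O)
    (hne : (omegaLimitSet φ).Nonempty) {c : ℝ}
    (hdec : ∀ M, IsCompact M → M ⊆ omegaLimitSet φ → (∀ x ∈ M, W x ≠ c) →
      ∃ Q, M ⊆ interior Q ∧ Q ⊆ O ∧
        ∃ δ < 0, ∀ x ∈ Q, ∀ a ∈ setValuedLieDeriv N F W x, a ≤ δ) :
    Tendsto (fun t => W (φ t)) atTop (𝓝 c) := by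
  obtain ⟨y, hy⟩ := hne
  suffices hsuff : ∀ η > 0, ∀ᶠ t in atTop, |W (φ t) - c| ≤ η by
    rw [Metric.tendsto_nhds]
    intro ε hε
    filter_upwards [hsuff (ε / 2) (by positivity)] with t ht
    rw [Real.dist_eq]
    linarith
  intro η hη
  have hcontO : ContinuousOn (fun x => |W x - c|) O :=
    (hW.continuousOn.sub continuousOn_const).abs
  obtain ⟨Q, hMQ, hQO, δ, hδ, hQ⟩ := hdec (omegaLimitSet φ ∩ (fun x => |W x - c|) ⁻¹' Ici η)
    ((isCompact_omegaLimitSet hb).of_isClosed_subset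
      ((hcontO.mono hΩO).preimage_isClosed_of_isClosed (isClosed_omegaLimitSet φ) isClosed_Ici)
      inter_subset_left) inter_subset_left (by
        rintro x ⟨-, hx⟩ hxc
        simp only [hxc, mem_preimage, sub_self, abs_zero, mem_Ici] at hx
        linarith)
  -- The near-level region and the decay region together cover the limit set.
  have hUopen : IsOpen (O ∩ (fun x => |W x - c|) ⁻¹' Iio η ∪ O ∩ interior Q) :=
    (hcontO.isOpen_inter_preimage hO isOpen_Iio).union (hO.inter isOpen_interior)
  have hU := eventually_mem_of_omegaLimitSet_subset hb hUopen (fun x hx => by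
    rcases lt_or_ge (|W x - c|) η with h | h
    · exact Or.inl ⟨hΩO hx, h⟩
    · exact Or.inr ⟨hΩO hx, hMQ ⟨hx, h⟩⟩)
  obtain ⟨T, hT⟩ := eventually_atTop.1 (hU.and (eventually_ge_atTop (0 : ℝ)))
  have htrap : ∀ t ≥ T, φ t ∈ O ∧ (η ≤ |W (φ t) - c| → φ t ∈ interior Q) := by
    intro t ht
    rcases (hT t ht).1 with h | h
    · exact ⟨h.1, fun hle => absurd h.2 (not_lt.2 hle)⟩
    · exact ⟨h.1, fun _ => h.2⟩
  have hnot := hφ.not_eventually_mem hO hW hreg hQO hδ hQ hy (hΩO hy)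
  have hup : ∃ t₀ ≥ T, W (φ t₀) ≤ c + η := by
    by_contra! hcon
    refine hnot (eventually_atTop.2 ⟨T, fun t ht => interior_subset ((htrap t ht).2 ?_)⟩)
    exact le_trans (by linarith [hcon t ht]) (le_abs_self _)
  -- Once at or below `c - η`, the solution would be trapped there, hence in `Q` forever.
  have hlow : ∀ t ≥ T, c - η < W (φ t) := by
    by_contra! hcon
    obtain ⟨t₀, ht₀, hle⟩ := hcon
    have hstay := hφ.le_of_trapped hO hW hreg hQO hδ hQ (hT t₀ ht₀).2
      (fun t ht => htrap t (ht₀.le.trans ht)) (b := c - η) (by simp [abs_of_pos hη]) hle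
    refine hnot (eventually_atTop.2 ⟨t₀, fun t ht =>
      interior_subset ((htrap t (ht₀.le.trans ht)).2 ?_)⟩)
    exact le_trans (by linarith [hstay t ht]) (neg_le_abs _)
  obtain ⟨t₀, ht₀, hle⟩ := hup
  have hstay := hφ.le_of_trapped hO hW hreg hQO hδ hQ (hT t₀ ht₀).2
    (fun t ht => htrap t (ht₀.le.trans ht)) (b := c + η) (by simp [abs_of_pos hη]) hle
  filter_upwards [eventually_ge_atTop t₀] with t ht
  rw [abs_le]
  constructor <;> linarith [hstay t ht, hlow t (ht₀.le.trans ht)]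

/-- If `W` converges along a bounded solution, then no omega-limit point has a neighbourhood on
which `W` decreases at a uniform rate. -/
theorem IsSolution.notMem_interior_of_tendsto (hφ : IsSolution F φ)
    (hF : IsUpperSemicontinuous F) (hF_compact : ∀ x, IsCompact (F x))
    (hb : Bornology.IsBounded (φ '' Ici (0 : ℝ)))
    {O : Set (EuclideanSpace ℝ (Fin n))} (hO : IsOpen O) {W : EuclideanSpace ℝ (Fin n) → ℝ}
    (hW : LocallyLipschitzOn O W) (hreg : ∀ x ∈ O, IsRegularAt W x)
    {N Q : Set (EuclideanSpace ℝ (Fin n))} (hQO : Q ⊆ O) {δ : ℝ} (hδ : δ < 0)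
    (hQ : ∀ x ∈ Q, ∀ a ∈ setValuedLieDeriv N F W x, a ≤ δ) {c : ℝ}
    (hlim : Tendsto (fun t => W (φ t)) atTop (𝓝 c))
    {x : EuclideanSpace ℝ (Fin n)} (hx : x ∈ omegaLimitSet φ) : x ∉ interior Q := by
  intro hxQ
  obtain ⟨R, hR, hdist⟩ := hφ.exists_dist_le hF hF_compact hb
  obtain ⟨ρ, hρ, hball⟩ := Metric.mem_nhds_iff.1 (mem_interior_iff_mem_nhds.1 hxQ)
  obtain ⟨s, hs, hsx⟩ := hx
  -- From within `ρ / 2` of `x`, speed at most `R` keeps the solution in the `ρ`-ball for time `τ`.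
  set τ := ρ / (2 * R) with hτ
  have hτpos : 0 < τ := by positivity
  have hRτ : R * τ = ρ / 2 := by rw [hτ]; field_simp
  have hdecr : ∀ᶠ k in atTop, W (φ (s k + τ)) - W (φ (s k)) ≤ δ * τ := by
    filter_upwards [hs.eventually_ge_atTop 0,
      hsx.eventually (Metric.ball_mem_nhds x (half_pos hρ))] with k hk hkx
    have := hφ.sub_le_mul_of_forall_mem hO hW hreg hQO hQ hk (by linarith : s k ≤ s k + τ)
      fun t ht => hball <| by
        have h₁ := hdist (s k) t hk ht.1
        have h₂ : R * (t - s k) ≤ R * τ := by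
          gcongr
          linarith [ht.2]
        have h₃ := dist_triangle (φ t) (φ (s k)) x
        rw [Metric.mem_ball]
        linarith
    simpa using this
  have hzero : Tendsto (fun k => W (φ (s k + τ)) - W (φ (s k))) atTop (𝓝 (c - c)) :=
    (hlim.comp (tendsto_atTop_add_const_right _ τ hs)).sub (hlim.comp hs)
  have hle := le_of_tendsto hzero hdecr
  have := mul_neg_of_neg_of_pos hδ hτpos
  linarith

/-- An empty Lie derivative gives no constraint, in agreement with `max ∅ = -∞`. -/
theorem le_of_iSup_maxLieDeriv_le {N Q : Set (EuclideanSpace ℝ (Fin n))}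
    {W : EuclideanSpace ℝ (Fin n) → ℝ} {δ : ℝ}
    (h : (⨆ x ∈ Q, maxLieDeriv N F W x) ≤ (δ : EReal)) :
    ∀ x ∈ Q, ∀ a ∈ setValuedLieDeriv N F W x, a ≤ δ := by
  intro x hx a ha
  have h₁ : (a : EReal) ≤ maxLieDeriv N F W x := le_sSup (mem_image_of_mem _ ha)
  exact EReal.coe_le_coe_iff.1 (h₁.trans ((le_iSup₂ x hx).trans h))

end NonsmoothLaSalle

/-! ### The invariance principle -/

theorem propositionA1 {n : ℕ}
    (F : EuclideanSpace ℝ (Fin n) → Set (EuclideanSpace ℝ (Fin n)))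
    (hF : NonsmoothLaSalle.IsUpperSemicontinuous F)
    (hF_nonempty : ∀ x, (F x).Nonempty)
    (hF_convex : ∀ x, Convex ℝ (F x))
    (hF_compact : ∀ x, IsCompact (F x))
    (φ : ℝ → EuclideanSpace ℝ (Fin n))
    (hφ : NonsmoothLaSalle.IsSolution F φ)
    (hφ_bounded : Bornology.IsBounded (φ '' Set.Ici (0 : ℝ)))
    (r : WithTop ℕ∞) (hr : 1 ≤ r)
    (S : Set (EuclideanSpace ℝ (Fin n)))
    (hS_closed : IsClosed S)
    (hS : NonsmoothLaSalle.IsEmbeddedSubmanifold r S)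
    (hφS : NonsmoothLaSalle.omegaLimitSet φ ⊆ S)
    (O : Set (EuclideanSpace ℝ (Fin n))) (hO : IsOpen O) (hSO : S ⊆ O)
    (W : EuclideanSpace ℝ (Fin n) → ℝ)
    (hW_lipschitz : LocallyLipschitzOn O W)
    (hW_regular : ∀ x ∈ O, NonsmoothLaSalle.IsRegularAt W x)
    (N : Set (EuclideanSpace ℝ (Fin n))) (hN : MeasureTheory.volume N = 0)
    (E : Set (EuclideanSpace ℝ (Fin n)))
    (hE : E = {x | x ∈ S ∧ (0 : ℝ) ∈ NonsmoothLaSalle.setValuedLieDeriv N F W x})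
    (hE_level : ∃ c : ℝ, ∀ x ∈ E, W x = c)
    (hE_neg : ∀ M : Set (EuclideanSpace ℝ (Fin n)), IsCompact M → M ⊆ S → Disjoint M E →
      ∃ Mc : Set (EuclideanSpace ℝ (Fin n)),
        IsCompact Mc ∧ M ⊆ interior Mc ∧ Mc ⊆ O ∧
        ∃ δ : ℝ, δ < 0 ∧ (⨆ x ∈ Mc, NonsmoothLaSalle.maxLieDeriv N F W x) ≤ (δ : EReal)) :
    NonsmoothLaSalle.omegaLimitSet φ ⊆ E := by
  obtain ⟨c, hc⟩ := hE_level
  have hΩO := hφS.trans hSO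
  have hdec : ∀ M, IsCompact M → M ⊆ NonsmoothLaSalle.omegaLimitSet φ → Disjoint M E →
      ∃ Q, M ⊆ interior Q ∧ Q ⊆ O ∧
        ∃ δ < 0, ∀ x ∈ Q, ∀ a ∈ NonsmoothLaSalle.setValuedLieDeriv N F W x, a ≤ δ := by
    intro M hM hMΩ hME
    obtain ⟨Q, -, hMQ, hQO, δ, hδ, hQ⟩ := hE_neg M hM (hMΩ.trans hφS) hME
    exact ⟨Q, hMQ, hQO, δ, hδ, NonsmoothLaSalle.le_of_iSup_maxLieDeriv_le hQ⟩
  intro x hx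
  by_contra hxE
  have hlim : Tendsto (fun t => W (φ t)) atTop (𝓝 c) :=
    hφ.tendsto_comp hφ_bounded hO hW_lipschitz hW_regular hΩO ⟨x, hx⟩ fun M hM hMΩ hMc =>
      hdec M hM hMΩ (disjoint_left.2 fun y hyM hyE => hMc y hyM (hc y hyE))
  obtain ⟨Q, hMQ, hQO, δ, hδ, hQ⟩ := hdec {x} isCompact_singleton
    (singleton_subset_iff.2 hx) (disjoint_singleton_left.2 hxE)
  exact hφ.notMem_interior_of_tendsto hF hF_compact hφ_bounded hO hW_lipschitz hW_regular hQO hδ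
    hQ hlim hx (hMQ rfl)
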